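/- Let $n\ge 0$, $g_1,\dots,g_n>0$, $0<\xi_1<\dots<\xi_n\le 1$ and $g=\sum_{i=1}^n g_i\delta_{\xi_i}$. Differential equations below hold in the sense of distributions for continuous complex-valued functions, the string being continued without mass outside $[0,1]$; derivatives at $\xi=0$ and $\xi=1$ are right-hand derivatives (this matters only at $1$, when $\xi_n=1$). Put $(f,h)_g=\int_{[0,1]} f h\,dg=\sum_i g_i f(\xi_i)h(\xi_i)$ on $L^2_g$. For $a=0,1,2$ the *cubic string problem of Type $a$* is $$-\phi_{\xi\xi\xi}=z\,g\,\phi,\qquad \phi(0)=\phi_\xi(0)=0,\qquad \text{with } \phi(1)=0\ (a=0),\quad \phi_\xi(1)=0\ (a=1),\quad \phi_{\xi\xi}(1)=0\ (a=2),$$ and the *adjoint problem of Type $a$* is $$\phi^*_{\xi\xi\xi}=z\,g\,\phi^*,\qquad \phi^*(0)=0,\qquad \text{with } \phi^*(1)=\phi^*_\xi(1)=0\ (a=0),\quad \phi^*(1)=\phi^*_{\xi\xi}(1)=0\ (a=1),\quad \phi^*_\xi(1)=\phi^*_{\xi\xi}(1)=0\ (a=2).$$ The spectrum is the set of $z\in\mathbb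 C$ for which there is a solution that does not vanish identically on $[0,1]$ (an eigenfunction). For every $z\in\mathbb C$ the equation $-\phi_{\xi\xi\xi}=zg\phi$ has a unique solution $\phi(\xi;z)$ with $\phi(0)=\phi_\xi(0)=0$, $\phi_{\xi\xi}(0)=1$, and for each $a$ the equation $\phi^*_{\xi\xi\xi}=zg\phi^*$ has a unique solution $\phi_a^*(\xi;z)$ for which, among $\phi^*(1),\phi^*_\xi(1),\phi^*_{\xi\xi}(1)$, the value $\phi^*_{\xi\xi}(1)$ (if $a=0$), $\phi^*_{\xi}(1)$ (if $a=1$), $\phi^*(1)$ (if $a=2$) is $1$ and the other two are $0$. Moreover, for each $a=0,1,2$: 1. The adjoint problem of Type $a$ and the cubic string problem of Type $a$ have the same spectrum; denote its distinct elements by $z_{a,j}$. The functions $\phi_{a,j}=\phi(\cdot;z_{a,j})$ and $\phi^*_{a,j}=\phi^*_a(\cdot;z_{a,j})$ are eigenfunctions of the cubic string problem and of the adjoint problem of Type $a$, respectively. 2. $(\phi_{a,i},\phi^*_{a,j})_g=0$ whenever $i\ne j$. 3. For $i=j$, $$(\phi_{a,i},\phi^*_{a,i})_g=\begin{cases}-\phi_z(1;z_{0,i})\neq0,&a=0,\\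 \phi_{\xi z}(1;z_{1,i})\neq0,&a=1,\\ -\phi_{\xi\xi z}(1;z_{2,i})\neq0,&a=2.\end{cases}$$ -/

import Mathlib

open MeasureTheory
open scoped ContDiff

namespace CubicString

/-- The discrete mass distribution `g = ∑ i, m i • δ_{x i}`, as a measure on `ℝ`. -/
noncomputable def massMeasure {n : ℕ} (x m : Fin n → ℝ) : Measure ℝ :=
  ∑ i, ENNReal.ofReal (m i) • Measure.dirac (x i)

/-- `u''' = c g u` in the sense of distributions, for a continuous function `u`.
Functions live on the whole line: the string is continued without mass beyond its two ends,
so that right-hand boundary values make sense even if a mass sits at the end point `1`. -/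
def ThirdDerivEq (g : Measure ℝ) (c : ℂ) (u : ℝ → ℂ) : Prop :=
  Continuous u ∧
    ∀ ψ : ℝ → ℂ, ContDiff ℝ ∞ ψ → HasCompactSupport ψ →
      -∫ ξ, u ξ * iteratedDeriv 3 ψ ξ = c * ∫ ξ, u ξ * ψ ξ ∂g

/-- The cubic string equation `-φ''' = z g φ`. -/
def IsSolution (g : Measure ℝ) (z : ℂ) (φ : ℝ → ℂ) : Prop :=
  ThirdDerivEq g (-z) φ

/-- The adjoint cubic string equation `φ*''' = z g φ*`. -/
def IsAdjointSolution (g : Measure ℝ) (z : ℂ) (φ : ℝ → ℂ) : Prop :=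
  ThirdDerivEq g z φ

/-- The `k`-th right-hand derivative of `u` at the point `p`. -/
noncomputable def rightDeriv (k : ℕ) (u : ℝ → ℂ) (p : ℝ) : ℂ :=
  iteratedDerivWithin k u (Set.Ici p) p

/-- Initial value problem `φ(0) = φ'(0) = 0`, `φ''(0) = 1` for the cubic string. -/
def IsIVPSolution (g : Measure ℝ) (z : ℂ) (φ : ℝ → ℂ) : Prop :=
  IsSolution g z φ ∧ φ 0 = 0 ∧ rightDeriv 1 φ 0 = 0 ∧ rightDeriv 2 φ 0 = 1

/-- Initial conditions at `1` for the adjoint cubic string of Type `a`. -/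
def AdjointInitialCondition (a : Fin 3) (φ : ℝ → ℂ) : Prop :=
  match a with
  | 0 => φ 1 = 0 ∧ rightDeriv 1 φ 1 = 0 ∧ rightDeriv 2 φ 1 = 1
  | 1 => φ 1 = 0 ∧ rightDeriv 1 φ 1 = 1 ∧ rightDeriv 2 φ 1 = 0
  | 2 => φ 1 = 1 ∧ rightDeriv 1 φ 1 = 0 ∧ rightDeriv 2 φ 1 = 0

/-- Initial value problem of Type `a` for the adjoint cubic string. -/
def IsAdjointIVPSolution (g : Measure ℝ) (a : Fin 3) (z : ℂ) (φ : ℝ → ℂ) : Prop :=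
  IsAdjointSolution g z φ ∧ AdjointInitialCondition a φ

/-- Boundary conditions of Type `a` for the cubic string. -/
def BoundaryCondition (a : Fin 3) (φ : ℝ → ℂ) : Prop :=
  φ 0 = 0 ∧ rightDeriv 1 φ 0 = 0 ∧
    match a with
    | 0 => φ 1 = 0
    | 1 => rightDeriv 1 φ 1 = 0
    | 2 => rightDeriv 2 φ 1 = 0

/-- Boundary conditions of Type `a` for the adjoint cubic string. -/
def AdjointBoundaryCondition (a : Fin 3) (φ : ℝ → ℂ) : Prop :=
  φ 0 = 0 ∧
    match a with
    | 0 => φ 1 = 0 ∧ rightDeriv 1 φ 1 = 0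
    | 1 => φ 1 = 0 ∧ rightDeriv 2 φ 1 = 0
    | 2 => rightDeriv 1 φ 1 = 0 ∧ rightDeriv 2 φ 1 = 0

/-- `φ` is an eigenfunction of the Type `a` boundary value problem with eigenvalue `z`. -/
def IsEigenfunction (g : Measure ℝ) (a : Fin 3) (z : ℂ) (φ : ℝ → ℂ) : Prop :=
  IsSolution g z φ ∧ BoundaryCondition a φ ∧ ∃ ξ ∈ Set.Icc (0 : ℝ) 1, φ ξ ≠ 0

/-- `φ` is an eigenfunction of the adjoint Type `a` problem with eigenvalue `z`. -/
def IsAdjointEigenfunction (g : Measure ℝ) (a : Fin 3) (z : ℂ) (φ : ℝ → ℂ) : Prop :=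
  IsAdjointSolution g z φ ∧ AdjointBoundaryCondition a φ ∧ ∃ ξ ∈ Set.Icc (0 : ℝ) 1, φ ξ ≠ 0

/-- The spectrum of the cubic string boundary value problem of Type `a`. -/
def spectrum (g : Measure ℝ) (a : Fin 3) : Set ℂ :=
  {z | ∃ φ, IsEigenfunction g a z φ}

/-- The spectrum of the adjoint cubic string boundary value problem of Type `a`. -/
def adjointSpectrum (g : Measure ℝ) (a : Fin 3) : Set ℂ :=
  {z | ∃ φ, IsAdjointEigenfunction g a z φ}

/-- The bilinear pairing `(f, h)_g = ∫₀¹ f h dg` on `L²[0,1]_g`; a mass at `1` counts. -/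
noncomputable def pairing (g : Measure ℝ) (f h : ℝ → ℂ) : ℂ :=
  ∫ ξ in Set.Icc (0 : ℝ) 1, f ξ * h ξ ∂g

end CubicString

/-!
A distributional solution `u` of `u''' = c g u` with a discrete mass distribution is determined by
its jet `(u, u', u'')` at any point: between masses the jet follows its Taylor expansion, and at a
mass `m` only `u''` jumps, by `c m u`.

For the solution `φ_z` of the string and the solution `φ*_w` of the adjoint equation, the Lagrange
identity reads `(w - z) (φ_z, φ*_w)_g = (-1)ᵃ ∂ᵃφ_z(1) - φ*_w(0)`. Taking `z = w` identifies the two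
spectra with the zeros of `z ↦ ∂ᵃφ_z(1)`, taking two eigenvalues gives orthogonality, and
differentiating in `z` at `z = w` gives the diagonal pairings.

It remains to see that `∂ᵃφ_z(1)` has only simple zeros. It is a real polynomial in `-z`, and it is
separable because two kinds of alternating forms never vanish when it is paired with another entry
of the jet: `Im (f(s) conj g(s))` at a nonreal `s`, and the Wronskian at a real point. Both kinds
enjoy the same few sign rules, under which positivity propagates along the string.
-/

namespace CubicString

open Filter Topology Polynomial

section Distributions

variable {ψ : ℝ → ℂ}

theorem contDiff_iteratedDeriv (hψ : ContDiff ℝ ∞ ψ) (k : ℕ) :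
    ContDiff ℝ ∞ (iteratedDeriv k ψ) := by
  rw [iteratedDeriv_eq_iterate]
  exact hψ.iterate_deriv k

theorem hasDerivAt_iteratedDeriv (hψ : ContDiff ℝ ∞ ψ) (k : ℕ) (t : ℝ) :
    HasDerivAt (iteratedDeriv k ψ) (iteratedDeriv (k + 1) ψ t) t := by
  rw [iteratedDeriv_succ]
  exact ((contDiff_iteratedDeriv hψ k).differentiable (by simp) t).hasDerivAt

theorem hasCompactSupport_iteratedDeriv (hψ : HasCompactSupport ψ) (k : ℕ) :
    HasCompactSupport (iteratedDeriv k ψ) := by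
  induction k with
  | zero => simpa only [iteratedDeriv_zero] using hψ
  | succ k ih => simpa only [iteratedDeriv_succ] using ih.deriv

theorem integrable_mul_iteratedDeriv {w : ℝ → ℂ} (hw : Continuous w) (hψ : ContDiff ℝ ∞ ψ)
    (hc : HasCompactSupport ψ) (k : ℕ) : Integrable fun t => w t * iteratedDeriv k ψ t :=
  (hw.mul (contDiff_iteratedDeriv hψ k).continuous).integrable_of_hasCompactSupport
    (hasCompactSupport_iteratedDeriv hc k).mul_left

theorem hasDerivAt_eval_ofReal (P : ℂ[X]) (t : ℝ) :
    HasDerivAt (fun s : ℝ => P.eval (s : ℂ)) ((derivative P).eval (t : ℂ)) t :=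
  (P.hasDerivAt (t : ℂ)).comp_ofReal

theorem continuous_eval_ofReal (P : ℂ[X]) : Continuous fun t : ℝ => P.eval (t : ℂ) :=
  P.continuous.comp Complex.continuous_ofReal

theorem integral_eval_mul_iteratedDeriv (hψ : ContDiff ℝ ∞ ψ) (hc : HasCompactSupport ψ)
    (k : ℕ) (P : ℂ[X]) :
    ∫ t : ℝ, P.eval (t : ℂ) * iteratedDeriv k ψ t =
      (-1) ^ k * ∫ t : ℝ, (derivative^[k] P).eval (t : ℂ) * ψ t := by
  induction k generalizing P with
  | zero => simp
  | succ k ih =>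
    rw [integral_mul_deriv_eq_deriv_mul_of_integrable (fun t _ => hasDerivAt_eval_ofReal P t)
        (fun t _ => hasDerivAt_iteratedDeriv hψ k t)
        (integrable_mul_iteratedDeriv (continuous_eval_ofReal P) hψ hc (k + 1))
        (integrable_mul_iteratedDeriv (continuous_eval_ofReal _) hψ hc k)
        (integrable_mul_iteratedDeriv (continuous_eval_ofReal P) hψ hc k),
      ih, Function.iterate_succ_apply, pow_succ, mul_neg_one, neg_mul]

theorem integral_Ioi_pow_mul_iteratedDeriv (hψ : ContDiff ℝ ∞ ψ) (hc : HasCompactSupport ψ)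
    (ξ : ℝ) (k : ℕ) :
    ∫ t in Set.Ioi ξ, ((t - ξ : ℝ) : ℂ) ^ k / k.factorial * iteratedDeriv (k + 1) ψ t =
      (-1) ^ (k + 1) * ψ ξ := by
  induction k with
  | zero =>
    simpa [iteratedDeriv_one] using hc.integral_Ioi_deriv_eq (hψ.of_le (by simp)) ξ
  | succ k ih =>
    set f : ℕ → ℝ → ℂ := fun j t => ((t - ξ : ℝ) : ℂ) ^ j / j.factorial with hf
    have hf_cont (j : ℕ) : Continuous (f j) := by fun_prop
    have hf_deriv (t : ℝ) : HasDerivAt (f (k + 1)) (f k t) t := by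
      have := ((((hasDerivAt_id t).sub_const ξ).ofReal_comp).pow (k + 1)).div_const
        ((k + 1).factorial : ℂ)
      refine this.congr_deriv ?_
      simp only [hf, Nat.factorial_succ, id_eq, Nat.cast_mul, Nat.cast_add_one,
        Nat.add_sub_cancel, Complex.ofReal_one, mul_one]
      exact mul_div_mul_left _ _ (Nat.cast_add_one_ne_zero k)
    have h_prod (t : ℝ) : HasDerivAt (fun t => f (k + 1) t * iteratedDeriv (k + 1) ψ t)
        (f k t * iteratedDeriv (k + 1) ψ t + f (k + 1) t * iteratedDeriv (k + 2) ψ t) t :=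
      (hf_deriv t).mul (hasDerivAt_iteratedDeriv hψ (k + 1) t)
    have h_zero := integral_Ioi_of_hasDerivAt_of_tendsto (a := ξ) (m := 0)
      (h_prod ξ).continuousAt.continuousWithinAt (fun t _ => h_prod t)
      ((integrable_mul_iteratedDeriv (hf_cont k) hψ hc _).add
        (integrable_mul_iteratedDeriv (hf_cont (k + 1)) hψ hc _)).integrableOn
      ((hasCompactSupport_iteratedDeriv hc (k + 1)).mul_left.is_zero_at_infty.mono_left
        atTop_le_cocompact)
    rw [integral_add (integrable_mul_iteratedDeriv (hf_cont k) hψ hc _).integrableOn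
      (integrable_mul_iteratedDeriv (hf_cont (k + 1)) hψ hc _).integrableOn, ih] at h_zero
    have h_end : f (k + 1) ξ = 0 := by simp [hf]
    rw [h_end, zero_mul, sub_zero] at h_zero
    rw [eq_neg_of_add_eq_zero_right h_zero]
    ring

theorem exists_primitive_of_integral_eq_zero (hψ : ContDiff ℝ ∞ ψ) (hc : HasCompactSupport ψ)
    (h0 : ∫ t, ψ t = 0) :
    ∃ Ψ : ℝ → ℂ, ContDiff ℝ ∞ Ψ ∧ HasCompactSupport Ψ ∧ deriv Ψ = ψ := by
  obtain ⟨R, hR⟩ := hc.isCompact.isBounded.subset_ball 0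
  have hzero {t : ℝ} (ht : R ≤ |t|) : ψ t = 0 := by
    by_contra h
    have := hR (subset_tsupport ψ h)
    simp only [Metric.mem_ball, Real.dist_eq, sub_zero] at this
    exact this.not_ge ht
  have hderiv : deriv (fun t => ∫ s in (-R)..t, ψ s) = ψ :=
    funext fun t => hψ.continuous.deriv_integral ψ (-R) t
  refine ⟨fun t => ∫ s in (-R)..t, ψ s, ?_, ?_, hderiv⟩
  · rw [contDiff_infty_iff_deriv, hderiv]
    exact ⟨fun t => (hψ.continuous.integral_hasStrictDerivAt (-R) t).hasDerivAt.differentiableAt,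
      hψ⟩
  · refine HasCompactSupport.intro (isCompact_Icc (a := -R) (b := R)) fun t ht => ?_
    rcases lt_or_ge t (-R) with hlt | hge
    · refine intervalIntegral.integral_zero_ae (ae_of_all _ fun s hs => hzero ?_)
      rw [Set.uIoc_of_ge hlt.le] at hs
      exact le_abs.2 (Or.inr (le_neg.2 hs.2))
    · have hRt : R < t := not_le.1 fun h => ht ⟨hge, h⟩
      refine (intervalIntegral.integral_eq_integral_of_support_subset fun s hs => ?_).trans h0
      have := abs_lt.1 (not_le.1 fun h => hs (hzero h))
      exact ⟨this.1, (this.2.trans hRt).le⟩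

theorem integral_mul_iteratedDeriv_eq_of_succ {w : ℝ → ℂ} (hw : Continuous w) {k : ℕ}
    (h : ∀ ψ : ℝ → ℂ, ContDiff ℝ ∞ ψ → HasCompactSupport ψ →
      ∫ t, w t * iteratedDeriv (k + 1) ψ t = 0) :
    ∃ c : ℂ, ∀ ψ : ℝ → ℂ, ContDiff ℝ ∞ ψ → HasCompactSupport ψ →
      ∫ t, w t * iteratedDeriv k ψ t = c * ∫ t, ψ t := by
  let b : ContDiffBump (0 : ℝ) := default
  let η : ℝ → ℂ := fun t => (b.normed volume t : ℂ)
  have hη : ContDiff ℝ ∞ η := Complex.ofRealCLM.contDiff.comp b.contDiff_normed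
  have hηc : HasCompactSupport η := b.hasCompactSupport_normed.comp_left Complex.ofReal_zero
  have hη1 : ∫ t, η t = 1 := by
    rw [integral_complex_ofReal, b.integral_normed, Complex.ofReal_one]
  refine ⟨∫ t, w t * iteratedDeriv k η t, fun ψ hψ hc => ?_⟩
  set I := ∫ t, ψ t
  have hηI : ContDiff ℝ ∞ fun t => I * η t := contDiff_const.mul hη
  obtain ⟨Ψ, hΨ, hΨc, hΨ'⟩ := exists_primitive_of_integral_eq_zero (ψ := fun t => ψ t - I * η t)
    (hψ.sub hηI) (hc.sub hηc.mul_left) (by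
      rw [integral_sub (hψ.continuous.integrable_of_hasCompactSupport hc)
        ((hη.continuous.integrable_of_hasCompactSupport hηc).const_mul I),
        integral_const_mul, hη1, mul_one, sub_self])
  have hpoint (t : ℝ) : w t * iteratedDeriv (k + 1) Ψ t =
      w t * iteratedDeriv k ψ t - I * (w t * iteratedDeriv k η t) := by
    rw [iteratedDeriv_succ', hΨ', iteratedDeriv_fun_sub (contDiff_infty.1 hψ k).contDiffAt
      (contDiff_infty.1 hηI k).contDiffAt, iteratedDeriv_const_mul_field]
    ring
  have := h Ψ hΨ hΨc
  simp only [hpoint] at this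
  rw [integral_sub (integrable_mul_iteratedDeriv hw hψ hc k)
    ((integrable_mul_iteratedDeriv hw hη hηc k).const_mul I), integral_const_mul] at this
  rw [sub_eq_zero.1 this, mul_comm]

theorem eq_zero_of_forall_integral_mul_eq_zero {w : ℝ → ℂ} (hw : Continuous w)
    (h : ∀ ψ : ℝ → ℂ, ContDiff ℝ ∞ ψ → HasCompactSupport ψ → ∫ t, w t * ψ t = 0) : w = 0 := by
  refine hw.ae_eq_iff_eq (μ := volume) continuous_zero |>.1 ?_
  refine ae_eq_zero_of_integral_contDiff_smul_eq_zero hw.locallyIntegrable fun g hg hgc => ?_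
  rw [← h (fun t => (g t : ℂ)) (Complex.ofRealCLM.contDiff.comp hg)
    (hgc.comp_left Complex.ofReal_zero)]
  exact integral_congr_ae (ae_of_all _ fun t => by simp [mul_comm])

theorem exists_polynomial_of_integral_mul_iteratedDeriv_eq_zero {w : ℝ → ℂ} (hw : Continuous w)
    {k : ℕ} (h : ∀ ψ : ℝ → ℂ, ContDiff ℝ ∞ ψ → HasCompactSupport ψ →
      ∫ t, w t * iteratedDeriv k ψ t = 0) :
    ∃ P : ℂ[X], P.degree < k ∧ ∀ t : ℝ, w t = P.eval (t : ℂ) := by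
  induction k generalizing w with
  | zero =>
    refine ⟨0, by simp, fun t => ?_⟩
    rw [eq_zero_of_forall_integral_mul_eq_zero hw (by simpa using h), Pi.zero_apply, eval_zero]
  | succ k ih =>
    obtain ⟨c, hc⟩ := integral_mul_iteratedDeriv_eq_of_succ hw h
    set Q : ℂ[X] := C (c * (-1) ^ k / k.factorial) * X ^ k with hQ
    have hQk : derivative^[k] Q = C (c * (-1) ^ k) := by
      rw [hQ, iterate_derivative_C_mul, iterate_derivative_X_pow_eq_C_mul, Nat.sub_self,
        pow_zero, mul_one, Nat.descFactorial_self, ← C_mul,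
        div_mul_cancel₀ _ (Nat.cast_ne_zero.2 k.factorial_ne_zero)]
    obtain ⟨P, hP, hwP⟩ := ih (w := fun t => w t - Q.eval (t : ℂ))
      (hw.sub (continuous_eval_ofReal Q)) fun ψ hψ hψc => by
        simp only [sub_mul]
        rw [integral_sub (integrable_mul_iteratedDeriv hw hψ hψc k)
            (integrable_mul_iteratedDeriv (continuous_eval_ofReal Q) hψ hψc k),
          hc ψ hψ hψc, integral_eval_mul_iteratedDeriv hψ hψc, hQk]
        simp only [eval_C, integral_const_mul]
        rw [mul_left_comm, mul_assoc, ← mul_assoc ((-1) ^ k), ← mul_pow, neg_one_mul, neg_neg,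
          one_pow, one_mul, sub_self]
    refine ⟨P + Q, (degree_add_le P Q).trans_lt (max_lt (hP.trans ?_) ?_), fun t => ?_⟩
    · exact_mod_cast k.lt_succ_self
    · exact (degree_C_mul_X_pow_le _ _).trans_lt (by exact_mod_cast k.lt_succ_self)
    · rw [eval_add, ← hwP, sub_add_cancel]

end Distributions

section Propagation

variable {M N : Type*} [AddCommGroup M] [Module ℝ M] [AddCommGroup N] [Module ℝ N]

/-- The flow of `u''' = 0` on the jets `(u, u', u'')`: Taylor expansion over a massless interval
of signed length `l`. -/
noncomputable def transport (l : ℝ) : (Fin 3 → M) →ₗ[ℝ] (Fin 3 → M) where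
  toFun d := ![d 0 + l • d 1 + (l ^ 2 / 2) • d 2, d 1 + l • d 2, d 2]
  map_add' d e := by
    ext i
    fin_cases i <;> simp <;> module
  map_smul' r d := by
    ext i
    fin_cases i <;> simp <;> module

theorem transport_apply (l : ℝ) (d : Fin 3 → M) :
    transport l d = ![d 0 + l • d 1 + (l ^ 2 / 2) • d 2, d 1 + l • d 2, d 2] := rfl

@[simp]
theorem transport_zero (d : Fin 3 → M) : transport 0 d = d := by
  ext i
  fin_cases i <;> simp [transport_apply]

theorem transport_add (l l' : ℝ) (d : Fin 3 → M) :
    transport (l + l') d = transport l (transport l' d) := by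
  ext i
  fin_cases i <;> simp [transport_apply] <;> module

theorem transport_comp (f : M →ₗ[ℝ] N) (l : ℝ) (d : Fin 3 → M) :
    transport l (f ∘ d) = f ∘ transport l d := by
  ext i
  fin_cases i <;> simp [transport_apply]

/-- The signed number of times one passes `ξ` when moving from `p` to `q`. A mass at the point of
arrival has been passed, one at the point of departure has not; right-hand derivatives follow the
same convention. -/
noncomputable def crossing (p q ξ : ℝ) : ℝ :=
  (if ξ ≤ q then 1 else 0) - (if ξ ≤ p then 1 else 0)

@[simp]
theorem crossing_self (p ξ : ℝ) : crossing p p ξ = 0 :=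
  sub_self _

theorem crossing_of_mem_Ioc {p q ξ : ℝ} (hξ : ξ ∈ Set.Ioc p q) : crossing p q ξ = 1 := by
  simp [crossing, hξ.2, hξ.1.not_ge]

theorem eventually_crossing_eq (p q ξ : ℝ) :
    ∀ᶠ t in 𝓝[≥] q, crossing p t ξ = crossing p q ξ := by
  rcases le_or_gt ξ q with h | h
  · filter_upwards [self_mem_nhdsWithin] with t ht
    simp [crossing, h, h.trans ht]
  · filter_upwards [nhdsWithin_le_nhds (Iio_mem_nhds h)] with t ht
    simp [crossing, h.not_ge, (Set.mem_Iio.1 ht).not_ge]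

/-- The fundamental solution of `u''' = δ_ξ` whose jet at `p` vanishes. -/
noncomputable def pointResponse (p ξ t : ℝ) : ℝ :=
  crossing p t ξ * ((t - ξ) ^ 2 / 2)

variable {ι : Type*} [Fintype ι] {x m : ι → ℝ}

/-- The jet at `q` of a function that has the jet `d` at `p` and whose second derivative jumps by
`m i • v i` at each `x i`. -/
noncomputable def propagate (x m : ι → ℝ) (p : ℝ) (d : Fin 3 → M) (v : ι → M) (q : ℝ) :
    Fin 3 → M :=
  transport (q - p) d + ∑ i, (m i * crossing p q (x i)) • transport (q - x i) (Pi.single 2 (v i))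

@[simp]
theorem propagate_self (p : ℝ) (d : Fin 3 → M) (v : ι → M) : propagate x m p d v p = d := by
  simp [propagate]

theorem propagate_apply_zero (p : ℝ) (d : Fin 3 → M) (v : ι → M) (q : ℝ) :
    propagate x m p d v q 0 =
      transport (q - p) d 0 + ∑ i, (m i * pointResponse p (x i) q) • v i := by
  simp [propagate, pointResponse, transport_apply, smul_smul, mul_assoc]

theorem propagate_comp (f : M →ₗ[ℝ] N) (p : ℝ) (d : Fin 3 → M) (v : ι → M) (q : ℝ) :
    propagate x m p (f ∘ d) (f ∘ v) q = f ∘ propagate x m p d v q := by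
  have hsingle (i : ι) : Pi.single (2 : Fin 3) (f (v i)) = f ∘ Pi.single 2 (v i) :=
    funext fun k => (Pi.apply_single (fun _ => f) (fun _ => map_zero f) 2 (v i) k).symm
  ext k
  simp [propagate, transport_comp, hsingle]

theorem eventually_propagate_eq (p : ℝ) (d : Fin 3 → M) (v : ι → M) (q : ℝ) :
    ∀ᶠ t in 𝓝[≥] q, propagate x m p d v t = transport (t - q) (propagate x m p d v q) := by
  filter_upwards [eventually_all.2 fun i => eventually_crossing_eq p q (x i)] with t ht
  simp only [propagate, ht, map_add, map_sum, map_smul, ← transport_add, sub_add_sub_cancel]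

theorem pointResponse_eq_zero_of_le {p ξ t : ℝ} (hp : p < ξ) (ht : t ≤ ξ) :
    pointResponse p ξ t = 0 := by
  rcases ht.eq_or_lt with rfl | ht
  · simp [pointResponse]
  · simp [pointResponse, crossing, hp.not_ge, ht.not_ge]

theorem propagate_eq_update_add [DecidableEq ι] (p : ℝ) (d : Fin 3 → M) (v : ι → M) (q : ℝ)
    (a : ι) : propagate x m p d v q = propagate x (Function.update m a 0) p d v q +
      (m a * crossing p q (x a)) • transport (q - x a) (Pi.single 2 (v a)) := by
  set y : ι → Fin 3 → M := fun i => transport (q - x i) (Pi.single 2 (v i))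
  have hterm (i : ι) : (m i * crossing p q (x i)) • y i =
      (Function.update m a 0 i * crossing p q (x i)) • y i +
        if i = a then (m a * crossing p q (x a)) • y a else 0 := by
    rcases eq_or_ne i a with rfl | hi <;> simp [*]
  rw [propagate, propagate, Finset.sum_congr rfl fun i _ => hterm i, Finset.sum_add_distrib,
    Fintype.sum_ite_eq', add_assoc]

theorem propagate_eq_transport (p : ℝ) (d : Fin 3 → M) (v : ι → M) {q t : ℝ} (hqt : q ≤ t)
    (h : ∀ i, m i ≠ 0 → x i ≤ q) :
    propagate x m p d v t = transport (t - q) (propagate x m p d v q) := by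
  have hcross (i : ι) : m i * crossing p t (x i) = m i * crossing p q (x i) := by
    by_cases hi : m i = 0
    · simp [hi]
    · simp [crossing, h i hi, (h i hi).trans hqt]
  simp only [propagate, hcross, map_add, map_sum, map_smul, ← transport_add, sub_add_sub_cancel]

end Propagation

section Jets

/-- The right-hand jet `(u, u', u'')` of `u` at `p`. -/
noncomputable def jet (u : ℝ → ℂ) (p : ℝ) : Fin 3 → ℂ :=
  fun k => rightDeriv k u p

@[simp]
theorem rightDeriv_zero (u : ℝ → ℂ) (p : ℝ) : rightDeriv 0 u p = u p :=
  congrFun iteratedDerivWithin_zero p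

theorem jet_const_mul (c : ℂ) (u : ℝ → ℂ) (p : ℝ) : jet (fun t => c * u t) p = c • jet u p := by
  ext k
  exact iteratedDerivWithin_const_mul_field c u

theorem jet_zero (p : ℝ) : jet 0 p = 0 := by
  simpa [Pi.zero_def] using jet_const_mul 0 0 p

theorem jet_congr {u w : ℝ → ℂ} {p : ℝ} (h : u =ᶠ[𝓝[≥] p] w) : jet u p = jet w p :=
  funext fun _ => h.iteratedDerivWithin_eq (h.eq_of_nhdsWithin Set.self_mem_Ici)

theorem jet_transport (d : Fin 3 → ℂ) (p : ℝ) : jet (fun t => transport (t - p) d 0) p = d := by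
  have hsub (t : ℝ) : HasDerivAt (fun t => t - p) 1 t := (hasDerivAt_id t).sub_const p
  have hd0 : deriv (fun t => transport (t - p) d 0) = fun t => transport (t - p) d 1 := by
    ext t
    refine ((((hsub t).smul_const (d 1)).const_add (d 0)).add
      ((((hsub t).pow 2).div_const 2).smul_const (d 2))).deriv.trans ?_
    simp [transport_apply]
  have hd1 : deriv (fun t => transport (t - p) d 1) = fun _ => d 2 := by
    ext t
    exact (((hsub t).smul_const (d 2)).const_add (d 1)).deriv.trans (one_smul ℝ (d 2))
  have hsmooth : ContDiff ℝ 2 fun t => transport (t - p) d 0 := by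
    change ContDiff ℝ 2 fun t => d 0 + (t - p) • d 1 + ((t - p) ^ 2 / 2) • d 2
    fun_prop
  have hjet (k : Fin 3) : jet (fun t => transport (t - p) d 0) p k =
      iteratedDeriv k (fun t => transport (t - p) d 0) p :=
    iteratedDerivWithin_eq_iteratedDeriv (uniqueDiffOn_Ici p)
      (hsmooth.of_le (by exact_mod_cast k.is_le)).contDiffAt Set.self_mem_Ici
  ext k
  rw [hjet]
  fin_cases k <;> simp [iteratedDeriv_succ, hd0, hd1]

variable {ι : Type*} [Fintype ι] {x m : ι → ℝ}

theorem jet_propagate (p : ℝ) (d : Fin 3 → ℂ) (v : ι → ℂ) (q : ℝ) :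
    jet (fun t => propagate x m p d v t 0) q = propagate x m p d v q := by
  rw [jet_congr ((eventually_propagate_eq p d v q).mono fun t ht => congrFun ht 0), jet_transport]

end Jets

section CauchyFormula

variable {ψ : ℝ → ℂ}

theorem exists_polynomial_eq_transport (p : ℝ) (d : Fin 3 → ℂ) :
    ∃ P : ℂ[X], P.degree < (3 : ℕ) ∧ ∀ t : ℝ, transport (t - p) d 0 = P.eval (t : ℂ) := by
  refine ⟨taylor (-p : ℂ) (C (d 2 / 2) * X ^ 2 + C (d 1) * X + C (d 0)), ?_, fun t => ?_⟩
  · rw [degree_taylor]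
    exact degree_quadratic_lt
  · rw [taylor_eval, ← sub_eq_add_neg]
    simp only [transport_apply, Matrix.cons_val_zero, Complex.real_smul, eval_add, eval_mul, eval_C,
      eval_pow, eval_X]
    push_cast
    ring

theorem exists_transport_eq_eval {P : ℂ[X]} (hP : P.degree < (3 : ℕ)) (p : ℝ) :
    ∃ d : Fin 3 → ℂ, ∀ t : ℝ, P.eval (t : ℂ) = transport (t - p) d 0 := by
  set Q := taylor (p : ℂ) P with hQ
  have hQdeg : Q.degree ≤ 2 := by
    rw [hQ, degree_taylor, degree_le_iff_coeff_zero]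
    exact fun k hk => (degree_lt_iff_coeff_zero P 3).1 hP k (by exact_mod_cast hk)
  refine ⟨![Q.coeff 0, Q.coeff 1, 2 * Q.coeff 2], fun t => ?_⟩
  rw [← taylor_eval_sub (p : ℂ), ← hQ,
    congrArg (eval _) (eq_quadratic_of_degree_le_two hQdeg)]
  simp only [transport_apply, Matrix.cons_val, Complex.real_smul, eval_add, eval_mul, eval_C,
    eval_pow, eval_X]
  push_cast
  ring

theorem integral_transport_mul_iteratedDeriv (p : ℝ) (d : Fin 3 → ℂ) (hψ : ContDiff ℝ ∞ ψ)
    (hc : HasCompactSupport ψ) : ∫ t, transport (t - p) d 0 * iteratedDeriv 3 ψ t = 0 := by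
  obtain ⟨P, hP, hPd⟩ := exists_polynomial_eq_transport p d
  simp only [hPd]
  rw [integral_eval_mul_iteratedDeriv hψ hc, iterate_derivative_eq_zero_of_degree_lt hP]
  simp

theorem continuous_and_integral_eq_zero_iff_exists_transport {w : ℝ → ℂ} (p : ℝ) :
    (Continuous w ∧ ∀ ψ : ℝ → ℂ, ContDiff ℝ ∞ ψ → HasCompactSupport ψ →
      ∫ t, w t * iteratedDeriv 3 ψ t = 0) ↔
      ∃ d : Fin 3 → ℂ, ∀ t, w t = transport (t - p) d 0 := by
  constructor
  · rintro ⟨hw, h⟩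
    obtain ⟨P, hP, hwP⟩ := exists_polynomial_of_integral_mul_iteratedDeriv_eq_zero hw h
    simpa only [hwP] using exists_transport_eq_eval hP p
  · rintro ⟨d, hd⟩
    obtain rfl := funext hd
    obtain ⟨P, -, hP⟩ := exists_polynomial_eq_transport p d
    exact ⟨(continuous_eval_ofReal P).congr fun t => (hP t).symm,
      fun ψ => integral_transport_mul_iteratedDeriv p d⟩

theorem pointResponse_eq_sub (p ξ t : ℝ) : pointResponse p ξ t =
    (max (t - ξ) 0) ^ 2 / 2 - (if ξ ≤ p then 1 else 0) * ((t - ξ) ^ 2 / 2) := by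
  rcases le_or_gt ξ t with h | h
  · simp [pointResponse, crossing, h, sub_mul]
  · simp [pointResponse, crossing, h.not_ge, h.le]

theorem continuous_pointResponse (p ξ : ℝ) : Continuous (pointResponse p ξ) := by
  rw [funext (pointResponse_eq_sub p ξ)]
  fun_prop

theorem integral_pointResponse_mul_iteratedDeriv (p ξ : ℝ) (hψ : ContDiff ℝ ∞ ψ)
    (hc : HasCompactSupport ψ) :
    ∫ t, (pointResponse p ξ t : ℂ) * iteratedDeriv 3 ψ t = -ψ ξ := by
  have hramp : ∫ t, (((max (t - ξ) 0) ^ 2 / 2 : ℝ) : ℂ) * iteratedDeriv 3 ψ t = -ψ ξ := by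
    rw [← setIntegral_eq_integral_of_forall_compl_eq_zero (s := Set.Ioi ξ) fun t ht => by
      simp [max_eq_right (sub_nonpos.2 (not_lt.1 (Set.notMem_Ioi.1 ht).not_gt))]]
    refine (setIntegral_congr_fun measurableSet_Ioi fun t ht => ?_).trans
      ((integral_Ioi_pow_mul_iteratedDeriv hψ hc ξ 2).trans (by ring))
    simp [max_eq_left (sub_pos.2 (Set.mem_Ioi.1 ht)).le, Nat.factorial]
  have hparabola : ∫ t, (((if ξ ≤ p then 1 else 0) * ((t - ξ) ^ 2 / 2) : ℝ) : ℂ) *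
      iteratedDeriv 3 ψ t = 0 := by
    rw [← integral_transport_mul_iteratedDeriv ξ (Pi.single 2 (if ξ ≤ p then 1 else 0)) hψ hc]
    congr! 3 with t
    split_ifs <;> simp [transport_apply]
  simp only [pointResponse_eq_sub, Complex.ofReal_sub, sub_mul]
  rw [integral_sub, hramp, hparabola, sub_zero] <;>
    exact integrable_mul_iteratedDeriv (by fun_prop) hψ hc 3

variable {n : ℕ} {x m : Fin n → ℝ}

theorem integral_massMeasure (hm : ∀ i, 0 ≤ m i) (f : ℝ → ℂ) :
    ∫ t, f t ∂massMeasure x m = ∑ i, m i * f (x i) := by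
  rw [massMeasure, integral_finsetSum_measure fun i _ =>
    (integrable_dirac (by simp)).smul_measure ENNReal.ofReal_ne_top]
  exact Finset.sum_congr rfl fun i _ => by
    rw [integral_smul_measure, integral_dirac, ENNReal.toReal_ofReal (hm i), Complex.real_smul]

theorem thirdDerivEq_iff_exists_propagate (hm : ∀ i, 0 ≤ m i) (c : ℂ) (u : ℝ → ℂ) (p : ℝ) :
    ThirdDerivEq (massMeasure x m) c u ↔
      ∃ d, ∀ t, u t = propagate x m p d (fun i => c * u (x i)) t 0 := by
  set K : ℝ → ℂ := fun t => ∑ i, (m i * pointResponse p (x i) t) • (c * u (x i)) with hK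
  have hKcont : Continuous K := continuous_finsetSum _ fun i _ =>
    ((continuous_pointResponse p (x i)).const_mul (m i)).smul continuous_const
  have hKint (ψ : ℝ → ℂ) (hψ : ContDiff ℝ ∞ ψ) (hc : HasCompactSupport ψ) :
      ∫ t, K t * iteratedDeriv 3 ψ t = -(c * ∫ t, u t * ψ t ∂massMeasure x m) := by
    have hterm (i : Fin n) (t : ℝ) :
        (m i * pointResponse p (x i) t) • (c * u (x i)) * iteratedDeriv 3 ψ t =
          m i * (c * u (x i)) * (pointResponse p (x i) t * iteratedDeriv 3 ψ t) := by
      rw [Complex.real_smul, Complex.ofReal_mul]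
      ring
    have hint (i : Fin n) : Integrable fun t =>
        m i * (c * u (x i)) * (pointResponse p (x i) t * iteratedDeriv 3 ψ t) :=
      (integrable_mul_iteratedDeriv
        (Complex.continuous_ofReal.comp (continuous_pointResponse p (x i))) hψ hc 3).const_mul _
    simp only [hK, Finset.sum_mul, hterm]
    rw [integral_finsetSum _ fun i _ => hint i]
    simp only [integral_const_mul, integral_pointResponse_mul_iteratedDeriv p _ hψ hc,
      integral_massMeasure hm, Finset.mul_sum, ← Finset.sum_neg_distrib]
    exact Finset.sum_congr rfl fun i _ => by ring
  simp only [propagate_apply_zero, ← sub_eq_iff_eq_add]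
  rw [← continuous_and_integral_eq_zero_iff_exists_transport]
  have hcont : (Continuous fun t => u t - K t) ↔ Continuous u :=
    ⟨fun h => (h.add hKcont).congr fun t => sub_add_cancel (u t) (K t), fun h => h.sub hKcont⟩
  refine Iff.trans (and_congr_right fun hu => ?_) (and_congr_left' hcont).symm
  refine forall₃_congr fun ψ hψ hc => ?_
  rw [neg_eq_iff_eq_neg, ← hKint ψ hψ hc, ← sub_eq_zero,
    ← integral_sub (integrable_mul_iteratedDeriv hu hψ hc 3)
      (integrable_mul_iteratedDeriv hKcont hψ hc 3)]
  simp only [sub_mul, hK]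

theorem thirdDerivEq_iff (hm : ∀ i, 0 ≤ m i) {c : ℂ} {u : ℝ → ℂ} (p : ℝ) :
    ThirdDerivEq (massMeasure x m) c u ↔
      ∀ t, u t = propagate x m p (jet u p) (fun i => c * u (x i)) t 0 := by
  rw [thirdDerivEq_iff_exists_propagate hm c u p]
  refine ⟨fun ⟨d, hd⟩ => ?_, fun h => ⟨_, h⟩⟩
  have hjet : jet u p = d := by
    rw [funext hd, jet_propagate, propagate_self]
  rwa [hjet]

theorem jet_eq_propagate (hm : ∀ i, 0 ≤ m i) {c : ℂ} {u : ℝ → ℂ}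
    (hu : ThirdDerivEq (massMeasure x m) c u) (p q : ℝ) :
    jet u q = propagate x m p (jet u p) (fun i => c * u (x i)) q := by
  conv_lhs => rw [funext ((thirdDerivEq_iff hm p).1 hu)]
  exact jet_propagate ..

end CauchyFormula

section CauchyProblem

theorem existsUnique_forall_eq_of_wellFounded {ι M : Type*} [Nonempty M] {r : ι → ι → Prop}
    (hr : WellFounded r) {F : (ι → M) → ι → M}
    (hF : ∀ v w k, (∀ i, r i k → v i = w i) → F v k = F w k) : ∃! v, ∀ k, v k = F v k := by
  classical
  let step (k : ι) (rec : ∀ i, r i k → M) : M :=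
    F (fun i => if h : r i k then rec i h else Classical.arbitrary M) k
  refine ⟨hr.fix step, fun k => ?_, fun w hw => funext fun k => ?_⟩
  · rw [hr.fix_eq]
    exact hF _ _ k fun i hi => dif_pos hi
  · induction k using hr.induction with
    | _ k ih =>
      rw [hw k, hr.fix_eq]
      exact hF _ _ k fun i hi => by rw [ih i hi, dif_pos hi]

theorem abs_sub_lt_of_pointResponse_ne_zero {p ξ t : ℝ} (h : pointResponse p ξ t ≠ 0) :
    |ξ - p| < |t - p| := by
  have hne : ξ ≠ t := by
    rintro rfl
    simp [pointResponse] at h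
  rcases le_or_gt ξ t with h1 | h1 <;> rcases le_or_gt ξ p with h2 | h2
  · simp [pointResponse, crossing, h1, h2] at h
  · rw [abs_of_pos (sub_pos.2 h2), abs_of_pos (sub_pos.2 (h2.trans_le h1))]
    exact sub_lt_sub_right (lt_of_le_of_ne h1 hne) p
  · rw [abs_of_nonpos (sub_nonpos.2 h2), abs_of_neg (sub_neg.2 (h1.trans_le h2))]
    exact neg_lt_neg (sub_lt_sub_right h1 p)
  · simp [pointResponse, crossing, h1.not_ge, h2.not_ge] at h

theorem existsUnique_nodal_values {ι M : Type*} [Fintype ι] [AddCommGroup M] [Module ℝ M]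
    (x m : ι → ℝ) (p : ℝ) (d : Fin 3 → M) (T : M → M) :
    ∃! v : ι → M, ∀ k, v k = propagate x m p d (T ∘ v) (x k) 0 := by
  have hwf : WellFounded (InvImage (· < ·) fun i => |x i - p|) :=
    Finite.wellFounded_of_trans_of_irrefl _
  refine existsUnique_forall_eq_of_wellFounded hwf fun v w k hvw => ?_
  simp only [propagate_apply_zero]
  congr! 2 with i
  by_cases h : pointResponse p (x i) (x k) = 0
  · simp [h]
  · rw [Function.comp_apply, Function.comp_apply, hvw i (abs_sub_lt_of_pointResponse_ne_zero h)]

variable {n : ℕ} {x m : Fin n → ℝ}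

theorem existsUnique_thirdDerivEq (hm : ∀ i, 0 ≤ m i) (c : ℂ) (p : ℝ) (d : Fin 3 → ℂ) :
    ∃! u, ThirdDerivEq (massMeasure x m) c u ∧ jet u p = d := by
  obtain ⟨v, hv, hv_unique⟩ := existsUnique_nodal_values x m p d (c * ·)
  refine ⟨fun t => propagate x m p d ((c * ·) ∘ v) t 0, ⟨?_, ?_⟩, ?_⟩
  · refine (thirdDerivEq_iff_exists_propagate hm c _ p).2 ⟨d, fun t => ?_⟩
    exact congrArg (propagate x m p d · t 0) (funext fun i => congrArg (c * ·) (hv i))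
  · rw [jet_propagate, propagate_self]
  · rintro u ⟨hu, rfl⟩
    have hu := (thirdDerivEq_iff hm p).1 hu
    rw [← hv_unique (u ∘ x) fun k => hu (x k)]
    exact funext hu

theorem ThirdDerivEq.const_mul {g : Measure ℝ} {c : ℂ} {u : ℝ → ℂ} (hu : ThirdDerivEq g c u)
    (D : ℂ) : ThirdDerivEq g c fun t => D * u t := by
  refine ⟨continuous_const.mul hu.1, fun ψ hψ hc => ?_⟩
  simp only [mul_assoc, integral_const_mul]
  rw [← mul_neg, hu.2 ψ hψ hc, mul_left_comm]

theorem ThirdDerivEq.eq_const_mul (hm : ∀ i, 0 ≤ m i) {c : ℂ} {u w : ℝ → ℂ}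
    (hu : ThirdDerivEq (massMeasure x m) c u) (hw : ThirdDerivEq (massMeasure x m) c w)
    {p : ℝ} {D : ℂ} (h : jet w p = D • jet u p) : w = fun t => D * u t :=
  (existsUnique_thirdDerivEq hm c p (jet w p)).unique ⟨hw, rfl⟩
    ⟨hu.const_mul D, (jet_const_mul D u p).trans h.symm⟩

theorem ThirdDerivEq.eq_zero_of_eventuallyEq_zero (hm : ∀ i, 0 ≤ m i) {c : ℂ} {u : ℝ → ℂ}
    (hu : ThirdDerivEq (massMeasure x m) c u) {p : ℝ} (h : u =ᶠ[𝓝[≥] p] 0) : u = 0 := by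
  rw [hu.eq_const_mul hm (D := 0) hu (by rw [jet_congr h, jet_zero, smul_zero])]
  simp [Pi.zero_def]

end CauchyProblem

section BoundaryConditions

theorem jet_eq_iff {u : ℝ → ℂ} {p : ℝ} {d : Fin 3 → ℂ} :
    jet u p = d ↔ u p = d 0 ∧ rightDeriv 1 u p = d 1 ∧ rightDeriv 2 u p = d 2 := by
  simp [funext_iff, Fin.forall_fin_succ, jet]

theorem isIVPSolution_iff {g : Measure ℝ} {z : ℂ} {u : ℝ → ℂ} :
    IsIVPSolution g z u ↔ IsSolution g z u ∧ jet u 0 = Pi.single 2 1 := by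
  simp [IsIVPSolution, jet_eq_iff]

theorem adjointInitialCondition_iff {a : Fin 3} {u : ℝ → ℂ} :
    AdjointInitialCondition a u ↔ jet u 1 = Pi.single a.rev 1 := by
  fin_cases a <;> simp [AdjointInitialCondition, jet_eq_iff, Fin.rev_eq]

theorem boundaryCondition_iff {a : Fin 3} {u : ℝ → ℂ} :
    BoundaryCondition a u ↔ u 0 = 0 ∧ rightDeriv 1 u 0 = 0 ∧ jet u 1 a = 0 := by
  fin_cases a <;> simp [BoundaryCondition, jet]

theorem adjointBoundaryCondition_iff {a : Fin 3} {u : ℝ → ℂ} :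
    AdjointBoundaryCondition a u ↔ u 0 = 0 ∧ ∃ D : ℂ, jet u 1 = D • Pi.single a.rev 1 := by
  fin_cases a <;> simp [AdjointBoundaryCondition, jet_eq_iff, Fin.rev_eq]

variable {n : ℕ} {x m : Fin n → ℝ}

theorem exists_mem_Icc_ne_zero (hm : ∀ i, 0 ≤ m i) {c : ℂ} {u : ℝ → ℂ}
    (hu : ThirdDerivEq (massMeasure x m) c u) (h0 : u ≠ 0) :
    ∃ ξ ∈ Set.Icc (0 : ℝ) 1, u ξ ≠ 0 := by
  contrapose! h0
  refine hu.eq_zero_of_eventuallyEq_zero (p := 0) hm ?_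
  filter_upwards [Icc_mem_nhdsGE zero_lt_one] using h0

theorem ne_zero_of_jet_eq_single {u : ℝ → ℂ} {p : ℝ} {k : Fin 3}
    (h : jet u p = Pi.single k 1) : u ≠ 0 := by
  rintro rfl
  simpa [jet_zero] using congrFun h k

section

variable {a : Fin 3} {z : ℂ} {φ : ℝ → ℂ}

theorem IsIVPSolution.isEigenfunction_iff (hm : ∀ i, 0 ≤ m i)
    (hφ : IsIVPSolution (massMeasure x m) z φ) :
    IsEigenfunction (massMeasure x m) a z φ ↔ jet φ 1 a = 0 := by
  rw [IsEigenfunction, boundaryCondition_iff]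
  refine ⟨fun h => h.2.1.2.2, fun h => ⟨hφ.1, ⟨hφ.2.1, hφ.2.2.1, h⟩, ?_⟩⟩
  exact exists_mem_Icc_ne_zero hm hφ.1 (ne_zero_of_jet_eq_single (isIVPSolution_iff.1 hφ).2)

theorem IsIVPSolution.mem_spectrum_iff (hm : ∀ i, 0 ≤ m i)
    (hφ : IsIVPSolution (massMeasure x m) z φ) :
    z ∈ spectrum (massMeasure x m) a ↔ jet φ 1 a = 0 := by
  refine ⟨fun ⟨u, hu, hbc, ξ, _, hξ⟩ => ?_, fun h => ⟨φ, (hφ.isEigenfunction_iff hm).2 h⟩⟩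
  obtain ⟨hφ_sol, hφ_jet⟩ := isIVPSolution_iff.1 hφ
  obtain ⟨h0, h1, ha⟩ := boundaryCondition_iff.1 hbc
  obtain ⟨D, rfl⟩ : ∃ D : ℂ, u = fun t => D * φ t := ⟨rightDeriv 2 u 0,
    ThirdDerivEq.eq_const_mul hm hφ_sol hu (p := 0) (by simp [hφ_jet, jet_eq_iff, h0, h1])⟩
  rw [jet_const_mul] at ha
  exact (mul_eq_zero.1 ha).resolve_left (left_ne_zero_of_mul hξ)

theorem IsAdjointIVPSolution.isAdjointEigenfunction_iff (hm : ∀ i, 0 ≤ m i)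
    (hφ : IsAdjointIVPSolution (massMeasure x m) a z φ) :
    IsAdjointEigenfunction (massMeasure x m) a z φ ↔ φ 0 = 0 := by
  have hjet := adjointInitialCondition_iff.1 hφ.2
  rw [IsAdjointEigenfunction, adjointBoundaryCondition_iff]
  refine ⟨fun h => h.2.1.1, fun h => ⟨hφ.1, ⟨h, 1, by rw [hjet, one_smul]⟩, ?_⟩⟩
  exact exists_mem_Icc_ne_zero hm hφ.1 (ne_zero_of_jet_eq_single hjet)

theorem IsAdjointIVPSolution.mem_adjointSpectrum_iff (hm : ∀ i, 0 ≤ m i)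
    (hφ : IsAdjointIVPSolution (massMeasure x m) a z φ) :
    z ∈ adjointSpectrum (massMeasure x m) a ↔ φ 0 = 0 := by
  refine ⟨fun ⟨u, hu, hbc, ξ, _, hξ⟩ => ?_,
    fun h => ⟨φ, (hφ.isAdjointEigenfunction_iff hm).2 h⟩⟩
  obtain ⟨h0, D, hD⟩ := adjointBoundaryCondition_iff.1 hbc
  obtain rfl : u = fun t => D * φ t :=
    ThirdDerivEq.eq_const_mul hm hφ.1 hu (p := 1)
      (hD.trans (by rw [adjointInitialCondition_iff.1 hφ.2]))
  exact (mul_eq_zero.1 h0).resolve_left (left_ne_zero_of_mul hξ)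

end

theorem existsUnique_isIVPSolution (hm : ∀ i, 0 ≤ m i) (z : ℂ) :
    ∃! u, IsIVPSolution (massMeasure x m) z u := by
  simpa only [isIVPSolution_iff, IsSolution] using
    existsUnique_thirdDerivEq hm (-z) 0 (Pi.single 2 1)

theorem existsUnique_isAdjointIVPSolution (hm : ∀ i, 0 ≤ m i) (a : Fin 3) (z : ℂ) :
    ∃! u, IsAdjointIVPSolution (massMeasure x m) a z u := by
  simpa only [IsAdjointIVPSolution, IsAdjointSolution, adjointInitialCondition_iff] using
    existsUnique_thirdDerivEq hm z 1 (Pi.single a.rev 1)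

end BoundaryConditions

section LagrangeIdentity

/-- The bilinear concomitant `u'' w - u' w' + u w''` of `d³/dt³`, as a form on jets. -/
noncomputable def concomitant : (Fin 3 → ℂ) →ₗ[ℝ] (Fin 3 → ℂ) →ₗ[ℝ] ℂ :=
  LinearMap.mk₂ ℝ (fun d e => d 2 * e 0 - d 1 * e 1 + d 0 * e 2)
    (fun _ _ _ => by simp only [Pi.add_apply]; ring)
    (fun _ _ _ => by simp only [Pi.smul_apply, Complex.real_smul]; ring)
    (fun _ _ _ => by simp only [Pi.add_apply]; ring)
    (fun _ _ _ => by simp only [Pi.smul_apply, Complex.real_smul]; ring)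

theorem concomitant_apply (d e : Fin 3 → ℂ) :
    concomitant d e = d 2 * e 0 - d 1 * e 1 + d 0 * e 2 := rfl

theorem concomitant_single_rev (d : Fin 3 → ℂ) (a : Fin 3) (y : ℂ) :
    concomitant d (Pi.single a.rev y) = (-1) ^ (a : ℕ) * d a * y := by
  fin_cases a <;> simp [concomitant_apply, Fin.rev_eq]

theorem concomitant_single_two_left (y : ℂ) (e : Fin 3 → ℂ) :
    concomitant (Pi.single 2 y) e = y * e 0 := by
  simp [concomitant_apply]

theorem concomitant_transport_left (l : ℝ) (d e : Fin 3 → ℂ) :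
    concomitant (transport l d) e = concomitant d (transport (-l) e) := by
  simp only [concomitant_apply, transport_apply, Matrix.cons_val, Complex.real_smul]
  push_cast
  ring

theorem crossing_mul_crossing_eq {ξ η : ℝ} (h : ξ ≠ η) (p q : ℝ) :
    crossing p q ξ * crossing q ξ η = crossing q p η * crossing p η ξ := by
  unfold crossing
  rcases h.lt_or_gt with h | h <;> split_ifs <;> linarith

theorem crossing_mul_pointResponse_eq (p q ξ η : ℝ) :
    crossing p q ξ * pointResponse q η ξ = crossing q p η * pointResponse p ξ η := by
  rcases eq_or_ne ξ η with rfl | h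
  · simp [pointResponse]
  · rw [pointResponse, pointResponse, ← mul_assoc, ← mul_assoc, crossing_mul_crossing_eq h]
    ring

theorem concomitant_transport_right (l : ℝ) (d e : Fin 3 → ℂ) :
    concomitant d (transport l e) = concomitant (transport (-l) d) e := by
  rw [concomitant_transport_left, neg_neg]

theorem concomitant_single_two_right (d : Fin 3 → ℂ) (y : ℂ) :
    concomitant d (Pi.single 2 y) = d 0 * y := by
  simp [concomitant_apply]

theorem crossing_swap (p q ξ : ℝ) : crossing q p ξ = -crossing p q ξ :=
  (neg_sub _ _).symm

variable {n : ℕ} {x m : Fin n → ℝ}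

/-- Integrating `(c + d) u w = u''' w + u w'''` over `(p, q]`. -/
theorem concomitant_jet_sub_concomitant_jet (hm : ∀ i, 0 ≤ m i) {c d : ℂ} {u w : ℝ → ℂ}
    (hu : ThirdDerivEq (massMeasure x m) c u) (hw : ThirdDerivEq (massMeasure x m) d w)
    (p q : ℝ) :
    concomitant (jet u q) (jet w q) - concomitant (jet u p) (jet w p) =
      (c + d) * ∑ i, m i * crossing p q (x i) * (u (x i) * w (x i)) := by
  have hu_node (j : Fin n) : transport (x j - p) (jet u p) 0 =
      u (x j) - ∑ i, (m i * pointResponse p (x i) (x j)) • (c * u (x i)) := by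
    rw [eq_sub_iff_add_eq, ← propagate_apply_zero, ← (thirdDerivEq_iff hm p).1 hu]
  have hw_node (i : Fin n) : transport (x i - q) (jet w q) 0 =
      w (x i) - ∑ j, (m j * pointResponse q (x j) (x i)) • (d * w (x j)) := by
    rw [eq_sub_iff_add_eq, ← propagate_apply_zero, ← (thirdDerivEq_iff hm q).1 hw]
  have h_left : concomitant (jet u q) (jet w q) =
      concomitant (jet u p) (transport (p - q) (jet w q)) +
        ∑ i, (m i * crossing p q (x i)) • (c * u (x i) * transport (x i - q) (jet w q) 0) := by
    rw [jet_eq_propagate hm hu p q]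
    simp only [propagate, map_add, map_sum, map_smul, LinearMap.add_apply, LinearMap.sum_apply,
      LinearMap.smul_apply, concomitant_transport_left, concomitant_single_two_left, neg_sub]
  have h_right : concomitant (jet u p) (jet w p) =
      concomitant (jet u p) (transport (p - q) (jet w q)) +
        ∑ j, (m j * crossing q p (x j)) • (transport (x j - p) (jet u p) 0 * (d * w (x j))) := by
    rw [jet_eq_propagate hm hw q p]
    simp only [propagate, map_add, map_sum, map_smul, concomitant_transport_right,
      concomitant_single_two_right, neg_sub]
  have h_double : ∑ i, ∑ j, (m i * crossing p q (x i)) •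
        (c * u (x i) * (m j * pointResponse q (x j) (x i)) • (d * w (x j))) =
      ∑ j, ∑ i, (m j * crossing q p (x j)) •
        ((m i * pointResponse p (x i) (x j)) • (c * u (x i)) * (d * w (x j))) := by
    rw [Finset.sum_comm]
    refine Finset.sum_congr rfl fun j _ => Finset.sum_congr rfl fun i _ => ?_
    rw [mul_smul_comm, smul_mul_assoc, smul_smul, smul_smul]
    congr 1
    linear_combination m i * m j * crossing_mul_pointResponse_eq p q (x i) (x j)
  rw [h_left, h_right, add_sub_add_left_eq_sub]
  simp only [hu_node, hw_node, mul_sub, sub_mul, smul_sub, Finset.sum_sub_distrib,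
    Finset.mul_sum, Finset.sum_mul, Finset.smul_sum]
  rw [h_double, sub_sub_sub_cancel_right, ← Finset.sum_sub_distrib]
  refine Finset.sum_congr rfl fun i _ => ?_
  simp only [crossing_swap p q, Complex.real_smul]
  push_cast
  ring

end LagrangeIdentity

section SpectralPolynomials

variable {ι : Type*} [Fintype ι] (x m : ι → ℝ)

theorem exists_jetPolynomial : ∃ J : ℝ → Fin 3 → ℝ[X],
    ∀ q, J q = propagate x m 0 (Pi.single 2 1) (fun i => X * J (x i) 0) q := by
  obtain ⟨v, hv, -⟩ := existsUnique_nodal_values x m 0 (Pi.single 2 1) ((X : ℝ[X]) * ·)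
  refine ⟨propagate x m 0 (Pi.single 2 1) ((X * ·) ∘ v), fun q => ?_⟩
  simp only [← hv]
  rfl

/-- The jet at `q` of the solution `φ(·; z)` of the cubic string, as a polynomial in `-z`. -/
noncomputable def jetPolynomial : ℝ → Fin 3 → ℝ[X] :=
  (exists_jetPolynomial x m).choose

theorem jetPolynomial_eq_propagate (q : ℝ) : jetPolynomial x m q =
    propagate x m 0 (Pi.single 2 1) (fun i => X * jetPolynomial x m (x i) 0) q :=
  (exists_jetPolynomial x m).choose_spec q

end SpectralPolynomials

section SpectralDerivative

variable {n : ℕ} {x m : Fin n → ℝ} {φ : ℂ → ℝ → ℂ}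

theorem IsIVPSolution.jet_eq_aeval (hm : ∀ i, 0 ≤ m i) {z : ℂ} {u : ℝ → ℂ}
    (hu : IsIVPSolution (massMeasure x m) z u) (q : ℝ) :
    jet u q = aeval (-z) ∘ jetPolynomial x m q := by
  obtain ⟨hu, hjet⟩ := isIVPSolution_iff.1 hu
  have h_single : aeval (-z) ∘ Pi.single (2 : Fin 3) (1 : ℝ[X]) = Pi.single 2 1 := by
    ext k
    fin_cases k <;> simp
  have h_aeval (v : Fin n → ℝ[X]) (q : ℝ) :
      aeval (-z) ∘ propagate x m 0 (Pi.single 2 1) (fun i => X * v i) q =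
        propagate x m 0 (Pi.single 2 1) (fun i => -z * aeval (-z) (v i)) q := by
    have h := propagate_comp (x := x) (m := m) (aeval (R := ℝ) (-z)).toLinearMap 0
      (Pi.single 2 1) (fun i => X * v i) q
    simp only [AlgHom.coe_toLinearMap, h_single, Function.comp_def, map_mul, aeval_X] at h
    exact h.symm
  have h_nodes : u ∘ x = fun i => aeval (-z) (jetPolynomial x m (x i) 0) := by
    refine (existsUnique_nodal_values x m 0 (Pi.single 2 1) (-z * ·)).unique (fun k => ?_)
      fun k => ?_
    · exact hjet ▸ (thirdDerivEq_iff hm 0).1 hu (x k)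
    · conv_lhs => rw [jetPolynomial_eq_propagate]
      exact congrFun (h_aeval _ (x k)) 0
  rw [jet_eq_propagate hm hu 0 q, hjet, jetPolynomial_eq_propagate, h_aeval]
  exact congrArg (propagate x m 0 _ · q) (funext fun i => congrArg (-z * ·) (congrFun h_nodes i))

theorem pairing_massMeasure (hm : ∀ i, 0 ≤ m i) (hx0 : ∀ i, 0 < x i) (hx1 : ∀ i, x i ≤ 1)
    (f h : ℝ → ℂ) : pairing (massMeasure x m) f h = ∑ i, m i * (f (x i) * h (x i)) := by
  rw [pairing, Measure.restrict_eq_self_of_ae_mem, integral_massMeasure hm]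
  rw [ae_iff, massMeasure, Measure.finsetSum_apply]
  exact Finset.sum_eq_zero fun i _ => by simp [(hx0 i).le, hx1 i]

theorem hasDerivAt_jet (hm : ∀ i, 0 ≤ m i)
    (hφ : ∀ z, IsIVPSolution (massMeasure x m) z (φ z)) (q : ℝ) (a : Fin 3) (z : ℂ) :
    HasDerivAt (fun z => jet (φ z) q a) (-aeval (-z) (derivative (jetPolynomial x m q a))) z := by
  simp only [fun z => (hφ z).jet_eq_aeval hm q, Function.comp_apply]
  rw [← mul_neg_one]
  exact ((jetPolynomial x m q a).hasDerivAt_aeval (-z)).comp z (hasDerivAt_neg z)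

theorem sub_mul_pairing_eq (hm : ∀ i, 0 ≤ m i) (hx0 : ∀ i, 0 < x i) (hx1 : ∀ i, x i ≤ 1)
    {a : Fin 3} {z w : ℂ} {u v : ℝ → ℂ} (hu : IsIVPSolution (massMeasure x m) z u)
    (hv : IsAdjointIVPSolution (massMeasure x m) a w v) :
    (w - z) * pairing (massMeasure x m) u v = (-1) ^ (a : ℕ) * jet u 1 a - v 0 := by
  obtain ⟨hu, hu0⟩ := isIVPSolution_iff.1 hu
  obtain ⟨hv, hv1⟩ := hv
  have h := concomitant_jet_sub_concomitant_jet hm hu hv 0 1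
  rw [hu0, adjointInitialCondition_iff.1 hv1, concomitant_single_rev, concomitant_single_two_left,
    neg_add_eq_sub] at h
  rw [pairing_massMeasure hm hx0 hx1]
  simpa [crossing_of_mem_Ioc ⟨hx0 _, hx1 _⟩, jet] using h.symm

theorem hasDerivAt_jet_one (hm : ∀ i, 0 ≤ m i) (hx0 : ∀ i, 0 < x i) (hx1 : ∀ i, x i ≤ 1)
    (hφ : ∀ z, IsIVPSolution (massMeasure x m) z (φ z)) {a : Fin 3} {w : ℂ} {v : ℝ → ℂ}
    (hv : IsAdjointIVPSolution (massMeasure x m) a w v) :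
    HasDerivAt (fun z => (-1) ^ (a : ℕ) * jet (φ z) 1 a)
      (-pairing (massMeasure x m) (φ w) v) w := by
  have hpairing : DifferentiableAt ℂ (fun z => pairing (massMeasure x m) (φ z) v) w := by
    simp only [pairing_massMeasure hm hx0 hx1]
    refine DifferentiableAt.fun_sum fun i _ => DifferentiableAt.const_mul ?_ _
    have hnode := (hasDerivAt_jet hm hφ (x i) 0 w).differentiableAt
    simp only [jet, Fin.val_zero, rightDeriv_zero] at hnode
    exact hnode.mul_const _
  have h_eq (z : ℂ) : (-1) ^ (a : ℕ) * jet (φ z) 1 a =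
      (w - z) * pairing (massMeasure x m) (φ z) v + v 0 :=
    eq_add_of_sub_eq (sub_mul_pairing_eq hm hx0 hx1 (hφ z) hv).symm
  simp only [h_eq]
  simpa using (((hasDerivAt_id w).const_sub w).mul hpairing.hasDerivAt).add_const (v 0)

end SpectralDerivative

section HerglotzForms

/-- An alternating form on real polynomials for which multiplication by `X` behaves like
multiplication by a point `s` of the upper half-plane behaves for `(f, g) ↦ Im (f(s) * conj g(s))`.
Letting `s` tend to a real point gives the Wronskian as a further example. -/
structure IsHerglotzForm (N : ℝ[X] →ₗ[ℝ] ℝ[X] →ₗ[ℝ] ℝ) : Prop where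
  isAlt : N.IsAlt
  X_one_pos : 0 < N X 1
  X_mul_self_nonneg (f : ℝ[X]) : 0 ≤ N (X * f) f
  X_mul_X_mul_nonneg {f g : ℝ[X]} (h : 0 ≤ N f g) : 0 ≤ N (X * f) (X * g)

/-- The form `(f, g) ↦ Im s * Im (f(s) * conj g(s))`; the factor `Im s` admits both half-planes. -/
noncomputable def imForm (s : ℂ) : ℝ[X] →ₗ[ℝ] ℝ[X] →ₗ[ℝ] ℝ :=
  LinearMap.mk₂ ℝ (fun f g => s.im * (aeval s f * starRingEnd ℂ (aeval s g)).im)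
    (fun _ _ _ => by simp only [map_add, add_mul, Complex.add_im, mul_add])
    (fun _ _ _ => by
      simp only [map_smul, smul_mul_assoc, Complex.smul_im, smul_eq_mul, mul_left_comm])
    (fun _ _ _ => by simp only [map_add, mul_add, Complex.add_im])
    (fun _ _ _ => by
      simp only [map_smul, Complex.real_smul, map_mul, Complex.conj_ofReal, smul_eq_mul,
        mul_left_comm _ (Complex.ofReal _), Complex.im_ofReal_mul, mul_left_comm])

theorem imForm_apply (s : ℂ) (f g : ℝ[X]) :
    imForm s f g = s.im * (aeval s f * starRingEnd ℂ (aeval s g)).im := rfl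

theorem isHerglotzForm_imForm {s : ℂ} (hs : s.im ≠ 0) : IsHerglotzForm (imForm s) where
  isAlt f := by simp [imForm_apply, Complex.mul_conj]
  X_one_pos := by
    simpa [imForm_apply] using mul_self_pos.2 hs
  X_mul_self_nonneg f := by
    rw [imForm_apply, map_mul, aeval_X, mul_assoc, Complex.mul_conj, Complex.im_mul_ofReal,
      ← mul_assoc]
    exact mul_nonneg (mul_self_nonneg _) (Complex.normSq_nonneg _)
  X_mul_X_mul_nonneg {f g} h := by
    rw [imForm_apply, map_mul, map_mul, aeval_X, map_mul, mul_mul_mul_comm, Complex.mul_conj,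
      Complex.im_ofReal_mul, mul_left_comm]
    exact mul_nonneg (Complex.normSq_nonneg _) h

/-- The Wronskian `(f, g) ↦ f'(t) * g(t) - f(t) * g'(t)` at the real point `t`. -/
noncomputable def wronskianForm (t : ℝ) : ℝ[X] →ₗ[ℝ] ℝ[X] →ₗ[ℝ] ℝ :=
  (wronskianBilin ℝ).compr₂ (-leval t)

theorem wronskianForm_apply (t : ℝ) (f g : ℝ[X]) :
    wronskianForm t f g = f.derivative.eval t * g.eval t - f.eval t * g.derivative.eval t := by
  simp [wronskianForm, wronskian, leval_apply]

theorem isHerglotzForm_wronskianForm (t : ℝ) : IsHerglotzForm (wronskianForm t) where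
  isAlt f := by rw [wronskianForm_apply, mul_comm, sub_self]
  X_one_pos := by simp [wronskianForm_apply]
  X_mul_self_nonneg f := by
    have : wronskianForm t (X * f) f = f.eval t * f.eval t := by
      simp only [wronskianForm_apply, derivative_mul, derivative_X, eval_add, eval_mul, eval_X,
        eval_one]
      ring
    exact this ▸ mul_self_nonneg _
  X_mul_X_mul_nonneg {f g} h := by
    have : wronskianForm t (X * f) (X * g) = t * t * wronskianForm t f g := by
      simp only [wronskianForm_apply, derivative_mul, derivative_X, eval_add, eval_mul, eval_X,
        eval_one]
      ring
    exact this ▸ mul_nonneg (mul_self_nonneg t) h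

theorem separable_of_forall_isHerglotzForm {F G : ℝ[X]}
    (h : ∀ N, IsHerglotzForm N → N F G ≠ 0) : F.Separable := by
  refine (isCoprime_iff_aeval_ne_zero_of_isAlgClosed ℝ ℂ F F.derivative).2 fun s => ?_
  by_contra! hroot
  by_cases hs : s.im = 0
  · obtain ⟨t, rfl⟩ : ∃ t : ℝ, (t : ℂ) = s := ⟨s.re, Complex.ext rfl hs.symm⟩
    have haeval (P : ℝ[X]) : aeval (t : ℂ) P = ((P.eval t : ℝ) : ℂ) := by
      simpa using aeval_algebraMap_apply ℂ t P
    simp only [haeval, Complex.ofReal_eq_zero] at hroot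
    exact h _ (isHerglotzForm_wronskianForm t) (by simp [wronskianForm_apply, hroot])
  · exact h _ (isHerglotzForm_imForm hs) (by simp [imForm_apply, hroot.1])

end HerglotzForms

section Simplicity

/-- Positivity of a jet of polynomials with respect to a form `N`. The six inequalities are chosen
so that both the massless flow and the jump at a mass preserve them; the strict ones are what
excludes nonreal and multiple zeros of the entries. -/
structure IsPositiveJet (N : ℝ[X] →ₗ[ℝ] ℝ[X] →ₗ[ℝ] ℝ) (d : Fin 3 → ℝ[X]) : Prop where
  nonneg_one_zero : 0 ≤ N (d 1) (d 0)
  nonneg_two_zero : 0 ≤ N (d 2) (d 0)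
  nonneg_two_one : 0 ≤ N (d 2) (d 1)
  pos_zero_one : 0 < N (X * d 0) (d 1)
  pos_zero_two : 0 < N (X * d 0) (d 2)
  pos_one_two : 0 < N (X * d 1) (d 2)

variable {N : ℝ[X] →ₗ[ℝ] ℝ[X] →ₗ[ℝ] ℝ} {d : Fin 3 → ℝ[X]}

theorem IsHerglotzForm.isPositiveJet_transport_single (hN : IsHerglotzForm N) {l : ℝ}
    (hl : 0 < l) : IsPositiveJet N (transport l (Pi.single 2 1)) where
  nonneg_one_zero := by simp [transport_apply, hN.isAlt.self_eq_zero]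
  nonneg_two_zero := by simp [transport_apply, hN.isAlt.self_eq_zero]
  nonneg_two_one := by simp [transport_apply, hN.isAlt.self_eq_zero]
  pos_zero_one := by simp [transport_apply, hl, hN.X_one_pos]
  pos_zero_two := by simp [transport_apply, hl, hN.X_one_pos]
  pos_one_two := by simp [transport_apply, hl, hN.X_one_pos]

theorem IsHerglotzForm.isPositiveJet_transport (hN : IsHerglotzForm N) (hd : IsPositiveJet N d)
    {l : ℝ} (hl : 0 ≤ l) : IsPositiveJet N (transport l d) := by
  obtain ⟨h10, h20, h21, h01, h02, h12⟩ := hd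
  have h22 : 0 ≤ N (X * d 2) (d 2) := hN.X_mul_self_nonneg (d 2)
  have hmid : 0 ≤ N (X * (d 1 + (l / 2) • d 2)) (d 1 + (l / 2) • d 2) := hN.X_mul_self_nonneg _
  have e10 : N (transport l d 1) (transport l d 0) =
      N (d 1) (d 0) + l * N (d 2) (d 0) + l ^ 2 / 2 * N (d 2) (d 1) := by
    simp [transport_apply, hN.isAlt.self_eq_zero, ← hN.isAlt.neg (d 2) (d 1)]
    ring
  have e20 : N (transport l d 2) (transport l d 0) =
      N (d 2) (d 0) + l * N (d 2) (d 1) := by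
    simp [transport_apply, hN.isAlt.self_eq_zero]
  have e21 : N (transport l d 2) (transport l d 1) = N (d 2) (d 1) := by
    simp [transport_apply, hN.isAlt.self_eq_zero]
  have e01 : N (X * transport l d 0) (transport l d 1) =
      N (X * d 0) (d 1) + l * N (X * d 0) (d 2) + l ^ 2 / 2 * N (X * d 1) (d 2) +
        l * N (X * (d 1 + (l / 2) • d 2)) (d 1 + (l / 2) • d 2) +
        l ^ 3 / 4 * N (X * d 2) (d 2) := by
    simp [transport_apply, mul_add]
    ring
  have e02 : N (X * transport l d 0) (transport l d 2) =
      N (X * d 0) (d 2) + l * N (X * d 1) (d 2) + l ^ 2 / 2 * N (X * d 2) (d 2) := by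
    simp [transport_apply, mul_add]
  have e12 : N (X * transport l d 1) (transport l d 2) =
      N (X * d 1) (d 2) + l * N (X * d 2) (d 2) := by
    simp [transport_apply, mul_add]
  constructor <;> simp only [e10, e20, e21, e01, e02, e12] <;> positivity

theorem IsHerglotzForm.isPositiveJet_add_single (hN : IsHerglotzForm N) (hd : IsPositiveJet N d)
    {μ : ℝ} (hμ : 0 ≤ μ) :
    IsPositiveJet N (d + (Pi.single 2 (μ • (X * d 0)) : Fin 3 → ℝ[X])) where
  nonneg_one_zero := by simpa using hd.nonneg_one_zero
  nonneg_two_zero := by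
    simpa using add_nonneg hd.nonneg_two_zero (mul_nonneg hμ (hN.X_mul_self_nonneg (d 0)))
  nonneg_two_one := by
    simpa using add_nonneg hd.nonneg_two_one (mul_nonneg hμ hd.pos_zero_one.le)
  pos_zero_one := by simpa using hd.pos_zero_one
  pos_zero_two := by simpa [hN.isAlt.self_eq_zero] using hd.pos_zero_two
  pos_one_two := by
    simpa using add_pos_of_pos_of_nonneg hd.pos_one_two
      (mul_nonneg hμ (hN.X_mul_X_mul_nonneg hd.nonneg_one_zero))

variable {ι : Type*} [Fintype ι] {x m : ι → ℝ}

theorem isPositiveJet_propagate (hN : IsHerglotzForm N) (hm : ∀ i, 0 ≤ m i) (hx : ∀ i, 0 < x i)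
    {v : ι → ℝ[X]} (S : Finset ι) (hS : ∀ i ∉ S, m i = 0)
    (hv : ∀ i ∈ S, v i = X * propagate x m 0 (Pi.single 2 1) v (x i) 0) {q : ℝ} (hq : 0 < q)
    (hSq : ∀ i ∈ S, x i ≤ q) : IsPositiveJet N (propagate x m 0 (Pi.single 2 1) v q) := by
  classical
  induction S using Finset.induction_on_max_value x generalizing m q with
  | empty => simpa [propagate, hS] using hN.isPositiveJet_transport_single hq
  | insert a S _ hmax ih =>
    have hqa := hSq a (Finset.mem_insert_self a S)
    set m' := Function.update m a 0 with hm'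
    set J := propagate x m' 0 (Pi.single 2 1) v (x a)
    have hS' (i : ι) (hi : i ∉ S) : m' i = 0 := by
      by_cases hia : i = a <;> simp_all [Function.update_of_ne]
    have h_left (t : ℝ) (ht : t ≤ x a) : propagate x m 0 (Pi.single 2 1) v t 0 =
        propagate x m' 0 (Pi.single 2 1) v t 0 := by
      simp only [propagate_apply_zero]
      congr! 2 with i
      rcases eq_or_ne i a with rfl | hi
      · simp [pointResponse_eq_zero_of_le (hx i) ht]
      · simp [hm', hi]
    have hJ_pos : IsPositiveJet N J := by
      refine ih (fun i => ?_) hS' (fun i hi => ?_) (hx a) hmax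
      · by_cases hia : i = a <;> simp [hm', hia, hm i]
      · rw [hv i (Finset.mem_insert_of_mem hi), h_left _ (hmax i hi)]
    have h_right : propagate x m 0 (Pi.single 2 1) v q =
        transport (q - x a) (J + (Pi.single 2 (m a • (X * J 0)) : Fin 3 → ℝ[X])) := by
      rw [propagate_eq_update_add _ _ _ _ a, ← hm',
        propagate_eq_transport _ _ _ hqa fun i hi => hmax i (not_imp_comm.1 (hS' i) hi),
        crossing_of_mem_Ioc ⟨hx a, hqa⟩, hv a (Finset.mem_insert_self a S), h_left _ le_rfl,
        mul_one, Pi.single_smul, map_add, map_smul]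
    exact h_right ▸ hN.isPositiveJet_transport (hN.isPositiveJet_add_single hJ_pos (hm a))
      (sub_nonneg.2 hqa)

theorem isPositiveJet_jetPolynomial (hN : IsHerglotzForm N) (hm : ∀ i, 0 ≤ m i)
    (hx : ∀ i, 0 < x i) {q : ℝ} (hq : 0 < q) (hxq : ∀ i, x i ≤ q) :
    IsPositiveJet N (jetPolynomial x m q) := by
  rw [jetPolynomial_eq_propagate]
  exact isPositiveJet_propagate hN hm hx Finset.univ (by simp)
    (fun i _ => by rw [← jetPolynomial_eq_propagate]) hq fun i _ => hxq i

theorem separable_jetPolynomial (hm : ∀ i, 0 ≤ m i) (hx : ∀ i, 0 < x i) {q : ℝ} (hq : 0 < q)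
    (hxq : ∀ i, x i ≤ q) (a : Fin 3) : (jetPolynomial x m q a).Separable := by
  have hpos (N) (hN : IsHerglotzForm N) : IsPositiveJet N (jetPolynomial x m q) :=
    isPositiveJet_jetPolynomial hN hm hx hq hxq
  fin_cases a
  · exact (separable_of_forall_isHerglotzForm fun N hN =>
      (hpos N hN).pos_zero_one.ne').of_mul_right
  · exact (separable_of_forall_isHerglotzForm fun N hN =>
      (hpos N hN).pos_one_two.ne').of_mul_right
  · refine separable_of_forall_isHerglotzForm (G := X * jetPolynomial x m q 0) fun N hN => ?_
    rw [← hN.isAlt.neg]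
    exact (neg_neg_of_pos (hpos N hN).pos_zero_two).ne

theorem deriv_jet_ne_zero {n : ℕ} {x m : Fin n → ℝ} (hm : ∀ i, 0 ≤ m i) (hx : ∀ i, 0 < x i)
    {φ : ℂ → ℝ → ℂ} (hφ : ∀ z, IsIVPSolution (massMeasure x m) z (φ z)) {q : ℝ} (hq : 0 < q)
    (hxq : ∀ i, x i ≤ q) {a : Fin 3} {z : ℂ} (hz : jet (φ z) q a = 0) :
    deriv (fun w => jet (φ w) q a) z ≠ 0 := by
  rw [(hasDerivAt_jet hm hφ q a z).deriv, neg_ne_zero]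
  refine (separable_jetPolynomial hm hx hq hxq a).aeval_derivative_ne_zero ?_
  rwa [(hφ z).jet_eq_aeval hm q] at hz

end Simplicity

section Spectra

variable {n : ℕ} {x m : Fin n → ℝ} {φ : ℂ → ℝ → ℂ}

theorem IsAdjointIVPSolution.apply_zero_eq (hm : ∀ i, 0 ≤ m i) (hx0 : ∀ i, 0 < x i)
    (hx1 : ∀ i, x i ≤ 1) {a : Fin 3} {z : ℂ} {u v : ℝ → ℂ}
    (hv : IsAdjointIVPSolution (massMeasure x m) a z v)
    (hu : IsIVPSolution (massMeasure x m) z u) :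
    v 0 = (-1) ^ (a : ℕ) * jet u 1 a := by
  rw [eq_comm, ← sub_eq_zero, ← sub_mul_pairing_eq hm hx0 hx1 hu hv, sub_self, zero_mul]

theorem adjointSpectrum_eq_spectrum (hm : ∀ i, 0 ≤ m i) (hx0 : ∀ i, 0 < x i)
    (hx1 : ∀ i, x i ≤ 1) (a : Fin 3) :
    adjointSpectrum (massMeasure x m) a = spectrum (massMeasure x m) a := by
  ext z
  obtain ⟨u, hu, -⟩ := existsUnique_isIVPSolution hm z
  obtain ⟨v, hv, -⟩ := existsUnique_isAdjointIVPSolution hm a z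
  rw [hv.mem_adjointSpectrum_iff hm, hu.mem_spectrum_iff hm, hv.apply_zero_eq hm hx0 hx1 hu]
  simp

theorem pairing_eq_zero (hm : ∀ i, 0 ≤ m i) (hx0 : ∀ i, 0 < x i) (hx1 : ∀ i, x i ≤ 1)
    {a : Fin 3} {z w : ℂ} {u v : ℝ → ℂ} (hu : IsIVPSolution (massMeasure x m) z u)
    (hv : IsAdjointIVPSolution (massMeasure x m) a w v)
    (hz : z ∈ spectrum (massMeasure x m) a) (hw : w ∈ spectrum (massMeasure x m) a)
    (hzw : z ≠ w) : pairing (massMeasure x m) u v = 0 := by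
  rw [← adjointSpectrum_eq_spectrum hm hx0 hx1, hv.mem_adjointSpectrum_iff hm] at hw
  rw [hu.mem_spectrum_iff hm] at hz
  have h := sub_mul_pairing_eq hm hx0 hx1 hu hv
  rw [hz, hw, mul_zero, sub_zero] at h
  exact (mul_eq_zero.1 h).resolve_left (sub_ne_zero.2 hzw.symm)

theorem pairing_self_eq_and_ne_zero (hm : ∀ i, 0 ≤ m i) (hx0 : ∀ i, 0 < x i)
    (hx1 : ∀ i, x i ≤ 1) (hφ : ∀ z, IsIVPSolution (massMeasure x m) z (φ z))
    {a : Fin 3} {z : ℂ} {v : ℝ → ℂ} (hv : IsAdjointIVPSolution (massMeasure x m) a z v)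
    (hz : z ∈ spectrum (massMeasure x m) a) :
    pairing (massMeasure x m) (φ z) v =
        (-1) ^ (a + 1 : ℕ) * deriv (fun w => rightDeriv a (φ w) 1) z ∧
      (-1) ^ (a + 1 : ℕ) * deriv (fun w => rightDeriv a (φ w) 1) z ≠ 0 := by
  constructor
  · have h := (hasDerivAt_jet_one hm hx0 hx1 hφ hv).deriv
    rw [deriv_const_mul _ (hasDerivAt_jet hm hφ 1 a z).differentiableAt] at h
    rw [pow_succ, mul_neg_one, neg_mul, ← neg_eq_iff_eq_neg]
    exact h.symm
  · exact mul_ne_zero (by simp)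
      (deriv_jet_ne_zero hm hx0 hφ one_pos hx1 (((hφ z).mem_spectrum_iff hm).1 hz))

end Spectra

end CubicString

theorem mainTheorem6 (n : ℕ) (x m : Fin n → ℝ)
    (hm : ∀ i, 0 < m i) (hx : StrictMono x) (hx0 : ∀ i, 0 < x i) (hx1 : ∀ i, x i ≤ 1) :
    (∀ z : ℂ, ∃! u : ℝ → ℂ, CubicString.IsIVPSolution (CubicString.massMeasure x m) z u) ∧
    (∀ (a : Fin 3) (z : ℂ),
      ∃! u : ℝ → ℂ, CubicString.IsAdjointIVPSolution (CubicString.massMeasure x m) a z u) ∧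
    ∀ (φ : ℂ → ℝ → ℂ) (φs : Fin 3 → ℂ → ℝ → ℂ),
      (∀ z, CubicString.IsIVPSolution (CubicString.massMeasure x m) z (φ z)) →
      (∀ a z, CubicString.IsAdjointIVPSolution (CubicString.massMeasure x m) a z (φs a z)) →
      -- the spectra coincide
      (∀ a, CubicString.adjointSpectrum (CubicString.massMeasure x m) a =
        CubicString.spectrum (CubicString.massMeasure x m) a) ∧
      -- the initial value solutions at the eigenvalues are eigenfunctions
      (∀ a, ∀ z ∈ CubicString.spectrum (CubicString.massMeasure x m) a,
        CubicString.IsEigenfunction (CubicString.massMeasure x m) a z (φ z) ∧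
        CubicString.IsAdjointEigenfunction (CubicString.massMeasure x m) a z (φs a z)) ∧
      -- biorthogonality
      (∀ a, ∀ z ∈ CubicString.spectrum (CubicString.massMeasure x m) a,
        ∀ w ∈ CubicString.spectrum (CubicString.massMeasure x m) a, z ≠ w →
          CubicString.pairing (CubicString.massMeasure x m) (φ z) (φs a w) = 0) ∧
      -- diagonal pairings
      (∀ z ∈ CubicString.spectrum (CubicString.massMeasure x m) 0,
        CubicString.pairing (CubicString.massMeasure x m) (φ z) (φs 0 z) =
          -deriv (fun w : ℂ => φ w 1) z ∧
        -deriv (fun w : ℂ => φ w 1) z ≠ 0) ∧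
      (∀ z ∈ CubicString.spectrum (CubicString.massMeasure x m) 1,
        CubicString.pairing (CubicString.massMeasure x m) (φ z) (φs 1 z) =
          deriv (fun w : ℂ => CubicString.rightDeriv 1 (φ w) 1) z ∧
        deriv (fun w : ℂ => CubicString.rightDeriv 1 (φ w) 1) z ≠ 0) ∧
      (∀ z ∈ CubicString.spectrum (CubicString.massMeasure x m) 2,
        CubicString.pairing (CubicString.massMeasure x m) (φ z) (φs 2 z) =
          -deriv (fun w : ℂ => CubicString.rightDeriv 2 (φ w) 1) z ∧
        -deriv (fun w : ℂ => CubicString.rightDeriv 2 (φ w) 1) z ≠ 0) := by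
  have hm : ∀ i, 0 ≤ m i := fun i => (hm i).le
  refine ⟨CubicString.existsUnique_isIVPSolution hm,
    CubicString.existsUnique_isAdjointIVPSolution hm, fun φ φs hφ hφs => ?_⟩
  have hspectra := CubicString.adjointSpectrum_eq_spectrum hm hx0 hx1
  have hpairing (a : Fin 3) (z : ℂ)
      (hz : z ∈ CubicString.spectrum (CubicString.massMeasure x m) a) :=
    CubicString.pairing_self_eq_and_ne_zero hm hx0 hx1 hφ (hφs a z) hz
  refine ⟨hspectra, fun a z hz => ⟨?_, ?_⟩, fun a z hz w hw hzw => ?_, ?_, ?_, ?_⟩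
  · exact ((hφ z).isEigenfunction_iff hm).2 (((hφ z).mem_spectrum_iff hm).1 hz)
  · exact ((hφs a z).isAdjointEigenfunction_iff hm).2
      (((hφs a z).mem_adjointSpectrum_iff hm).1 (hspectra a ▸ hz))
  · exact CubicString.pairing_eq_zero hm hx0 hx1 (hφ z) (hφs a w) hz hw hzw
  · simpa using hpairing 0
  · simpa using hpairing 1
  · simpa [pow_succ] using hpairing 2
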